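/- **Theorem (local linear convergence of BPG).** Let $D_X\in\mathbb R^{n\times n}$ and $D_Y\in\mathbb R^{m\times m}$ be symmetric, let $\mu\in\mathbb R^n$, $\nu\in\mathbb R^m$ (in the application, probability weights), and consider the discrete Gromov–Wasserstein problem $$\min_{\pi\in\mathbb R^{n\times m}} f(\pi):=-\operatorname{Tr}(D_X\pi D_Y\pi^T)\quad\text{s.t. }\pi\in C_1\cap C_2,$$ where $C_1=\{\pi\ge 0:\pi\mathbf 1_m=\mu\}$ and $C_2=\{\pi\ge 0:\pi^T\mathbf 1_n=\nu\}$. All norms and inner products are the Frobenius ones. Its critical point set is $$\mathcal X=\{\pi\in C_1\cap C_2:\ 0\in\nabla f(\pi)+\mathcal N_{C_1}(\pi)+\mathcal N_{C_2}(\pi)\},$$ with $\mathcal N_C(\pi)$ the normal cone to $C$ at $\pi$. Let $L_f\ge 0$ be a Lipschitz constant of $\nabla f$ on $\mathbb R^{n\times m}$. Let $h$ be a kernel function whose effective domain $\operatorname{dom}h$ contains all entrywise positive matrices, and suppose that $h$ is $\sigma$-strongly convex on $C_1\cap C_2\cap\operatorname{dom}h$ for some $\sigma>0$, and differentiable with locally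 Lipschitz gradient on the set of entrywise positive matrices. (Examples are the relative entropy $h(\pi)=\sum_{ij}\pi_{ij}\log\pi_{ij}$ with domain $\{\pi\ge 0\}$, and $h(\pi)=\tfrac12\|\pi\|^2$.) Write $D_h(x,y)=h(x)-h(y)-\langle\nabla h(y),x-y\rangle$. Let $\{\pi^k\}_{k\ge 0}$ be generated by Bregman proximal gradient (BPG): for every $k\ge 0$, $$\pi^{k+1}\in\operatorname*{arg\,min}_{\pi\in C_1\cap C_2\cap\operatorname{dom}h}\Big\{\langle\nabla f(\pi^k),\pi\rangle+\frac1{t_k}D_h(\pi,\pi^k)\Big\}.$$ Suppose that there are constants $\underline t,\overline t$ with $0<\underline t\le t_k<\overline t\le\sigma/L_f$ for all $k\ge 0$ (the last inequality read as $\overline t\,L_f\le\sigma$), and that there is $\varepsilon>0$ with $\pi^k_{ij}\ge\varepsilon$ for all $k\ge 0$ and all $i,j$. Then $\{\pi^k\}$ converges R-linearly to an element of $\mathcal X$: there exist $\pi^\star\in\mathcal X$, $\gamma>0$ and $\eta\in(0,1)$ such that $\|\pi^k-\pi^\star\|\le\gamma\,\eta^k$ for all $k\ge 0$. -/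

import Mathlib

open scoped Matrix NNReal

noncomputable section

/-- Real `n × m` matrices with the Frobenius norm and inner product. -/
abbrev Coupling (n m : ℕ) : Type := EuclideanSpace ℝ (Fin n × Fin m)

/-- The entries of a coupling, arranged as a matrix. -/
def couplingMatrix {n m : ℕ} (P : Coupling n m) : Matrix (Fin n) (Fin m) ℝ :=
  Matrix.of fun i j => P (i, j)

/-- The Gromov-Wasserstein objective `f(P) = -Tr(D_X P D_Y Pᵀ)`. -/
def gwObjective {n m : ℕ} (DX : Matrix (Fin n) (Fin n) ℝ) (DY : Matrix (Fin m) (Fin m) ℝ)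
    (P : Coupling n m) : ℝ :=
  -(DX * couplingMatrix P * DY * (couplingMatrix P)ᵀ).trace

/-- `C₁ = {P ≥ 0 : P 1 = μ}`. -/
def rowConstraint {n m : ℕ} (μ : Fin n → ℝ) : Set (Coupling n m) :=
  {P | (∀ p, 0 ≤ P p) ∧ couplingMatrix P *ᵥ 1 = μ}

/-- `C₂ = {P ≥ 0 : Pᵀ 1 = ν}`. -/
def colConstraint {n m : ℕ} (ν : Fin m → ℝ) : Set (Coupling n m) :=
  {P | (∀ p, 0 ≤ P p) ∧ (couplingMatrix P)ᵀ *ᵥ 1 = ν}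

/-- The feasible set `C₁ ∩ C₂`. -/
def feasible {n m : ℕ} (μ : Fin n → ℝ) (ν : Fin m → ℝ) : Set (Coupling n m) :=
  rowConstraint μ ∩ colConstraint ν

/-- The normal cone, in the sense of convex analysis, to `C` at a point `x` of `C`. -/
def normalCone {E : Type*} [NormedAddCommGroup E] [InnerProductSpace ℝ E]
    (C : Set E) (x : E) : Set E :=
  {v | ∀ y ∈ C, inner ℝ v (y - x) ≤ 0}

/-- The critical points: feasible `P` with `0 ∈ ∇f(P) + N_{C₁}(P) + N_{C₂}(P)`. -/
def gwCriticalSet {n m : ℕ} (DX : Matrix (Fin n) (Fin n) ℝ) (DY : Matrix (Fin m) (Fin m) ℝ)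
    (μ : Fin n → ℝ) (ν : Fin m → ℝ) : Set (Coupling n m) :=
  {P | P ∈ feasible μ ν ∧
    ∃ v ∈ normalCone (rowConstraint μ) P, ∃ w ∈ normalCone (colConstraint ν) P,
      gradient (gwObjective DX DY) P + v + w = 0}

/-- The Bregman divergence `D_h(x, y) = h(x) - h(y) - ⟨∇h(y), x - y⟩`. -/
def bregmanDiv {E : Type*} [NormedAddCommGroup E] [InnerProductSpace ℝ E] [CompleteSpace E]
    (h : E → ℝ) (x y : E) : ℝ :=
  h x - h y - inner ℝ (gradient h y) (x - y)

/-- The matrices all of whose entries are positive. -/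
def positiveOrthant (n m : ℕ) : Set (Coupling n m) :=
  {P | ∀ p, 0 < P p}

/-- `h`, with effective domain `dom`, is an admissible kernel for `C` with modulus `σ`:
it is `σ`-strongly convex on the part of `C` in its domain, and it is differentiable with locally
Lipschitz gradient at the entrywise positive matrices, which lie in its domain.
(`h` is to be thought of as `+∞` outside `dom`.) -/
structure IsBregmanKernel {n m : ℕ} (C dom : Set (Coupling n m)) (h : Coupling n m → ℝ)
    (σ : ℝ) : Prop where
  positive_subset : positiveOrthant n m ⊆ dom
  modulus_pos : 0 < σ
  strongConvexOn : StrongConvexOn (C ∩ dom) σ h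
  differentiableOn : DifferentiableOn ℝ h (positiveOrthant n m)
  locallyLipschitzOn : LocallyLipschitzOn (positiveOrthant n m) (gradient h)

/-- The objective of the Bregman proximal gradient step from `Q` with step size `t`:
`P ↦ ⟨∇f(Q), P⟩ + D_h(P, Q) / t`. -/
def bpgModel {n m : ℕ} (f h : Coupling n m → ℝ) (t : ℝ) (Q P : Coupling n m) : ℝ :=
  inner ℝ (gradient f Q) P + 1 / t * bregmanDiv h P Q

/-- `P` is generated by BPG with step sizes `t`: for every `k`, `P (k + 1)` minimizes over `C` (and
the effective domain of `h`) the model of the step from `P k`. -/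
def IsBPGSequence {n m : ℕ} (f : Coupling n m → ℝ) (C dom : Set (Coupling n m))
    (h : Coupling n m → ℝ) (t : ℕ → ℝ) (P : ℕ → Coupling n m) : Prop :=
  ∀ k, P (k + 1) ∈ C ∩ dom ∧ IsMinOn (bpgModel f h (t k) (P k)) (C ∩ dom) (P (k + 1))

/-- R-linear convergence of `x` to `xlim`. -/
def ConvergesRLinearly {E : Type*} [NormedAddCommGroup E] (x : ℕ → E) (xlim : E) : Prop :=
  ∃ γ η : ℝ, 0 < γ ∧ 0 < η ∧ η < 1 ∧ ∀ k, ‖x k - xlim‖ ≤ γ * η ^ k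

end

/-! The objective is the quadratic form `f(P) = ½⟨HP, P⟩` with `H` symmetric. Since all entries stay
above `ε`, the sign constraints are inactive along the sequence, and only the space `V` of matrices
with zero row and column sums matters. The optimality condition of a step (`bpgStep_inner_eq_zero`)
says that, along `V`, `HPᵏ` equals `-1/t` times the increment of `∇h`. Strong convexity of `h` turns
this into a decrease of `f` by a multiple of the squared step, and the Lipschitz bound on `∇h`
bounds the gradient along `V` by the step.

A cluster point `y` is therefore critical along `V`, so `f(Pᵏ) - f(y) = ½⟨H(Pᵏ - y), Pᵏ - y⟩`. A
quadratic form on `V`, even indefinite or degenerate, is bounded by the square of its gradient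
(`LinearMap.IsSymmetric.exists_abs_inner_le_sq`), so this gap is at most a multiple of the squared
step. With the decrease this makes the gap geometric, and the steps summable
(`exists_convergesRLinearly_of_descent`). -/

open Filter Topology

/-! ### Strong convexity, and descent for quadratic functions. -/

section Abstract

variable {E : Type*} [NormedAddCommGroup E] [InnerProductSpace ℝ E]

/-- The first-order inequality for a strongly convex function. -/
theorem StrongConvexOn.inner_gradient_add_le [CompleteSpace E] {s : Set E} {σ : ℝ} {h : E → ℝ}
    (hh : StrongConvexOn s σ h) {x y : E} (hx : x ∈ s) (hy : y ∈ s)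
    (hd : DifferentiableAt ℝ h x) :
    inner ℝ (gradient h x) (y - x) + σ / 2 * ‖y - x‖ ^ 2 ≤ h y - h x := by
  -- `h - σ/2 ‖·‖²`, restricted to the line through `x` and `y`, is convex: its derivative at `0` is
  -- at most its slope from `0` to `1`.
  have hc := (strongConvexOn_iff_convex.1 hh).comp_affineMap (AffineMap.lineMap x y)
  have hline : HasDerivAt (fun s : ℝ => AffineMap.lineMap x y s) (y - x) 0 :=
    AffineMap.hasDerivAt_lineMap
  have hgrad : HasFDerivAt h (InnerProductSpace.toDual ℝ E (gradient h x))
      (AffineMap.lineMap x y (0 : ℝ)) := by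
    simpa using hd.hasGradientAt.hasFDerivAt
  have h1 := hgrad.comp_hasDerivAt (0 : ℝ) hline
  rw [InnerProductSpace.toDual_apply_apply] at h1
  generalize gradient h x = g at h1 ⊢
  have h2 := (hline.norm_sq).const_mul (σ / 2)
  have h3 := h1.sub h2
  have h4 := hc.le_slope_of_hasDerivAt (x := 0) (y := 1) (by simpa using hx) (by simpa using hy)
    one_pos h3
  simp [slope_def_field] at h4
  have h5 : ‖y‖ ^ 2 = ‖x‖ ^ 2 + 2 * inner ℝ x (y - x) + ‖y - x‖ ^ 2 := by
    rw [← norm_add_sq_real, add_sub_cancel]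
  rw [h5] at h4
  linarith

/-- The gradient of a strongly convex function is strongly monotone. -/
theorem StrongConvexOn.le_inner_gradient_sub [CompleteSpace E] {s : Set E} {σ : ℝ} {h : E → ℝ}
    (hh : StrongConvexOn s σ h) {x y : E} (hx : x ∈ s) (hy : y ∈ s)
    (hdx : DifferentiableAt ℝ h x) (hdy : DifferentiableAt ℝ h y) :
    σ * ‖y - x‖ ^ 2 ≤ inner ℝ (gradient h y - gradient h x) (y - x) := by
  have h1 := hh.inner_gradient_add_le hx hy hdx
  have h2 := hh.inner_gradient_add_le hy hx hdy
  rw [norm_sub_rev x y, ← neg_sub y x, inner_neg_right] at h2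
  rw [inner_sub_left]
  linarith

/-- On a finite-dimensional subspace, a quadratic form is bounded by the square of its gradient. -/
theorem LinearMap.IsSymmetric.exists_abs_inner_le_sq [FiniteDimensional ℝ E] {H : E →ₗ[ℝ] E}
    (hH : H.IsSymmetric) (V : Submodule ℝ E) :
    ∃ C : ℝ, 0 < C ∧ ∀ v ∈ V, ∀ M : ℝ, 0 ≤ M → (∀ w ∈ V, |inner ℝ (H v) w| ≤ M * ‖w‖) →
      |inner ℝ (H v) v| ≤ C * M ^ 2 := by
  let B : V →ₗ[ℝ] V := V.orthogonalProjectionOnto.toLinearMap ∘ₗ H ∘ₗ V.subtype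
  have hB : ∀ v w : V, inner ℝ (B v) w = inner ℝ (H v) (w : E) := fun v w => by
    simp [B]
  -- `B` is the compression of `H` to `V`. It may be singular, but a right inverse on its range
  -- gives `w` with `B w = B v'` and norm controlled by `‖B v'‖`; symmetry then lets `w` replace
  -- `v'` in the quadratic form.
  obtain ⟨r, hr⟩ := B.rangeRestrict.exists_rightInverse_of_surjective
    (LinearMap.range_rangeRestrict B)
  let R := LinearMap.toContinuousLinearMap r
  refine ⟨‖R‖ + 1, by positivity, fun v hv M hM0 hM => ?_⟩
  let v' : V := ⟨v, hv⟩
  have hBM : ‖B v'‖ ≤ M := by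
    rcases eq_or_ne (B v') 0 with h0 | h0
    · rwa [h0, norm_zero]
    · have h1 := hM (B v') (B v').2
      rw [← hB v' (B v'), real_inner_self_eq_norm_sq, abs_of_nonneg (by positivity), sq] at h1
      exact le_of_mul_le_mul_right h1 (norm_pos_iff.2 h0)
  let w : V := R ⟨B v', v', rfl⟩
  have hw : B w = B v' := congrArg Subtype.val (LinearMap.congr_fun hr ⟨B v', v', rfl⟩)
  have hwn : ‖w‖ ≤ ‖R‖ * ‖B v'‖ := R.le_opNorm _
  have key : inner ℝ (H v) v = inner ℝ (B v') w := by
    calc inner ℝ (H v) v = inner ℝ (B v') v' := (hB v' v').symm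
      _ = inner ℝ (B w) v' := by rw [hw]
      _ = inner ℝ (H w) v := hB w v'
      _ = inner ℝ (w : E) (H v) := hH _ _
      _ = inner ℝ (H v) (w : E) := real_inner_comm _ _
      _ = inner ℝ (B v') w := (hB v' w).symm
  rw [key]
  calc |inner ℝ (B v') w| ≤ ‖B v'‖ * ‖w‖ := abs_real_inner_le_norm _ _
    _ ≤ ‖B v'‖ * (‖R‖ * ‖B v'‖) := by gcongr
    _ = ‖R‖ * ‖B v'‖ ^ 2 := by ring
    _ ≤ (‖R‖ + 1) * M ^ 2 := by gcongr; linarith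

/-- A sequence whose steps are controlled both ways by the decrease of a nonnegative merit value
converges R-linearly. -/
theorem exists_convergesRLinearly_of_descent {E : Type*} [NormedAddCommGroup E] [CompleteSpace E]
    {x : ℕ → E} {e : ℕ → ℝ} {a c : ℝ}
    (ha : 0 < a) (he : ∀ k, 0 ≤ e k) (hdesc : ∀ k, a * ‖x (k + 1) - x k‖ ^ 2 ≤ e k - e (k + 1))
    (hc : ∀ k, e k ≤ c * ‖x (k + 1) - x k‖ ^ 2) :
    ∃ y, Tendsto x atTop (𝓝 y) ∧ ConvergesRLinearly x y := by
  -- The entry `2 * a` ensures `0 < b` and `a / b < 1`, whatever the sign or size of `c`.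
  let b := max c (2 * a)
  have hb : 0 < b := lt_of_lt_of_le (by positivity) (le_max_right _ _)
  have hab : a / b < 1 := (div_lt_one hb).2 (lt_of_lt_of_le (by linarith) (le_max_right _ _))
  let q := 1 - a / b
  have hq0 : 0 < q := by simp only [q]; linarith
  have hq1 : q < 1 := by have : 0 < a / b := by positivity
                         simp only [q]; linarith
  have hstep : ∀ k, e (k + 1) ≤ q * e k := fun k => by
    have h1 : e k ≤ b * ‖x (k + 1) - x k‖ ^ 2 :=
      (hc k).trans (by gcongr; exact le_max_left _ _)
    have h2 : a / b * e k ≤ a * ‖x (k + 1) - x k‖ ^ 2 := by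
      calc a / b * e k ≤ a / b * (b * ‖x (k + 1) - x k‖ ^ 2) := by gcongr
        _ = _ := by field_simp
    have := hdesc k
    simp only [q]
    linarith
  have hgeo : ∀ k, e k ≤ e 0 * q ^ k := fun k => by
    induction k with
    | zero => simp
    | succ k ih =>
      calc e (k + 1) ≤ q * e k := hstep k
        _ ≤ q * (e 0 * q ^ k) := by gcongr
        _ = _ := by ring
  -- The merit value bounds the squared step, so the rate for the steps is the square root.
  let r := √q
  have hr0 : 0 < r := Real.sqrt_pos.2 hq0
  have hr1 : r < 1 := by rw [Real.sqrt_lt' one_pos]; simpa using hq1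
  have hdist : ∀ k, dist (x k) (x (k + 1)) ≤ √(e 0 / a) * r ^ k := fun k => by
    rw [dist_comm, dist_eq_norm]
    refine abs_le_of_sq_le_sq' ?_ (by positivity) |>.2
    rw [mul_pow, Real.sq_sqrt (div_nonneg (he 0) ha.le), ← pow_mul, mul_comm k 2, pow_mul,
      Real.sq_sqrt hq0.le, div_mul_eq_mul_div, le_div_iff₀ ha]
    linarith [hdesc k, he (k + 1), hgeo k]
  obtain ⟨y, hy⟩ := cauchySeq_tendsto_of_complete (cauchySeq_of_le_geometric _ _ hr1 hdist)
  refine ⟨y, hy, √(e 0 / a) / (1 - r) + 1, r, ?_, hr0, hr1, fun k => ?_⟩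
  · have : 0 < 1 - r := by linarith
    positivity
  · have := dist_le_of_le_geometric_of_tendsto _ _ hr1 hdist hy k
    rw [dist_eq_norm] at this
    refine this.trans ?_
    rw [add_mul, div_mul_eq_mul_div]
    linarith [pow_pos hr0 k]

/-- Needed because the starting point of BPG is not assumed feasible; the descent argument covers
only the later iterates. -/
theorem ConvergesRLinearly.of_succ {E : Type*} [NormedAddCommGroup E] {x : ℕ → E} {y : E}
    (hx : ConvergesRLinearly (fun k => x (k + 1)) y) : ConvergesRLinearly x y := by
  obtain ⟨γ, η, hγ, hη, hη1, hx⟩ := hx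
  refine ⟨γ / η + ‖x 0 - y‖, η, by positivity, hη, hη1, fun k => ?_⟩
  cases k with
  | zero =>
    have : 0 < γ / η := by positivity
    simp only [pow_zero, mul_one]
    linarith
  | succ k =>
    calc ‖x (k + 1) - y‖ ≤ γ * η ^ k := hx k
      _ = γ / η * η ^ (k + 1) := by rw [pow_succ]; field_simp
      _ ≤ (γ / η + ‖x 0 - y‖) * η ^ (k + 1) := by gcongr; linarith [norm_nonneg (x 0 - y)]

/-- A descent sequence for a quadratic function on a compact piece of an affine subspace, whose
steps bound the gradient along the subspace, converges R-linearly to a critical point. -/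
theorem LinearMap.IsSymmetric.exists_convergesRLinearly [FiniteDimensional ℝ E] {H : E →ₗ[ℝ] E}
    (hH : H.IsSymmetric) (V : Submodule ℝ E) {K : Set E} (hK : IsCompact K)
    (hKV : ∀ x ∈ K, ∀ y ∈ K, x - y ∈ V) {x : ℕ → E} (hx : ∀ k, x k ∈ K) {a c : ℝ} (ha : 0 < a)
    (hc : 0 ≤ c) (hdesc : ∀ k, a * ‖x (k + 1) - x k‖ ^ 2 ≤
      1 / 2 * inner ℝ (H (x k)) (x k) - 1 / 2 * inner ℝ (H (x (k + 1))) (x (k + 1)))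
    (hstat : ∀ k, ∀ w ∈ V, |inner ℝ (H (x k)) w| ≤ c * ‖x (k + 1) - x k‖ * ‖w‖) :
    ∃ y ∈ K, (∀ w ∈ V, inner ℝ (H y) w = 0) ∧ ConvergesRLinearly x y := by
  have : CompleteSpace E := FiniteDimensional.complete ℝ E
  have hHc : Continuous H := H.continuous_of_finiteDimensional
  let q : E → ℝ := fun z => 1 / 2 * inner ℝ (H z) z
  have hqc : Continuous q := by fun_prop
  obtain ⟨y, hyK, φ, hφ, hφy⟩ := hK.tendsto_subseq hx
  have hanti : Antitone (fun k => q (x k)) := antitone_nat_of_succ_le fun k => by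
    have := hdesc k
    have : 0 ≤ a * ‖x (k + 1) - x k‖ ^ 2 := by positivity
    simp only [q]; linarith
  -- Monotonicity upgrades convergence of the values along the subsequence to the whole sequence.
  have hq : Tendsto (fun k => q (x k)) atTop (𝓝 (q y)) :=
    (tendsto_iff_tendsto_subseq_of_antitone hanti hφ.tendsto_atTop).2
      ((hqc.tendsto y).comp hφy)
  have hstep : Tendsto (fun k => ‖x (k + 1) - x k‖) atTop (𝓝 0) := by
    have h1 : Tendsto (fun k => (q (x k) - q (x (k + 1))) / a) atTop (𝓝 0) := by
      simpa using (hq.sub (hq.comp (tendsto_add_atTop_nat 1))).div_const a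
    have h2 : Tendsto (fun k => ‖x (k + 1) - x k‖ ^ 2) atTop (𝓝 0) :=
      squeeze_zero (fun k => by positivity)
        (fun k => by simp only [q]; rw [le_div_iff₀ ha]; linarith [hdesc k]) h1
    simpa using h2.sqrt
  have hcrit : ∀ w ∈ V, inner ℝ (H y) w = 0 := fun w hw => by
    have h1 : Tendsto (fun k => inner ℝ (H (x (φ k))) w) atTop (𝓝 (inner ℝ (H y) w)) :=
      ((hHc.tendsto y).comp hφy).inner tendsto_const_nhds
    have h2 : Tendsto (fun k => c * ‖x (φ k + 1) - x (φ k)‖ * ‖w‖) atTop (𝓝 0) := by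
      simpa using ((hstep.comp hφ.tendsto_atTop).const_mul c).mul_const ‖w‖
    exact tendsto_nhds_unique h1 (squeeze_zero_norm (fun k => hstat (φ k) w hw) h2)
  obtain ⟨C, hC, hCb⟩ := hH.exists_abs_inner_le_sq V
  -- The linear term of the expansion at `y` vanishes, as `x k - y ∈ V`.
  have hquad : ∀ k, q (x k) - q y = 1 / 2 * inner ℝ (H (x k - y)) (x k - y) := fun k => by
    have h1 := hcrit _ (hKV _ (hx k) _ hyK)
    have h2 : inner ℝ (H (x k)) y = inner ℝ (H y) (x k) := by
      rw [hH, real_inner_comm]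
    simp only [q, map_sub, inner_sub_left, inner_sub_right] at h1 ⊢
    linarith
  obtain ⟨z, hz, hlin⟩ := exists_convergesRLinearly_of_descent (x := x)
    (e := fun k => q (x k) - q y) (a := a) (c := 1 / 2 * (C * c ^ 2)) ha
    (fun k => sub_nonneg.2 (hanti.le_of_tendsto hq k))
    (fun k => by have := hdesc k; simp only [q]; linarith)
    (fun k => by
      rw [hquad]
      have := hCb (x k - y) (hKV _ (hx k) _ hyK) (c * ‖x (k + 1) - x k‖) (by positivity) (fun w hw => by
        rw [map_sub, inner_sub_left, hcrit w hw, sub_zero]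
        exact hstat k w hw)
      have h2 := (le_abs_self _).trans this
      rw [mul_pow] at h2
      linarith)
  rw [tendsto_nhds_unique (hz.comp hφ.tendsto_atTop) hφy] at hlin
  exact ⟨y, hyK, hcrit, hlin⟩

end Abstract

/-! ### The quadratic structure of the objective. -/

noncomputable section GromovWasserstein

variable {n m : ℕ}

/-- The Hessian `P ↦ -2 D_X P D_Y` of the Gromov-Wasserstein objective. -/
def gwHessian (DX : Matrix (Fin n) (Fin n) ℝ) (DY : Matrix (Fin m) (Fin m) ℝ) :
    Coupling n m →ₗ[ℝ] Coupling n m where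
  toFun P := WithLp.toLp 2 fun p => -2 * (DX * couplingMatrix P * DY) p.1 p.2
  map_add' P Q := by
    have : couplingMatrix (P + Q) = couplingMatrix P + couplingMatrix Q := rfl
    ext p
    simp [this, Matrix.mul_add, Matrix.add_mul]
    ring
  map_smul' c P := by
    have : couplingMatrix (c • P) = c • couplingMatrix P := rfl
    ext p
    simp [this]
    ring

theorem inner_gwHessian (DX : Matrix (Fin n) (Fin n) ℝ) (DY : Matrix (Fin m) (Fin m) ℝ)
    (P Q : Coupling n m) :
    inner ℝ (gwHessian DX DY P) Q =
      -2 * (DX * couplingMatrix P * DY * (couplingMatrix Q)ᵀ).trace := by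
  rw [PiLp.inner_apply, Fintype.sum_prod_type, Matrix.trace, Finset.mul_sum]
  refine Finset.sum_congr rfl fun i _ => ?_
  rw [Matrix.diag_apply, Matrix.mul_apply, Finset.mul_sum]
  refine Finset.sum_congr rfl fun j _ => ?_
  simp [gwHessian, couplingMatrix]
  ring

theorem gwHessian_isSymmetric {DX : Matrix (Fin n) (Fin n) ℝ} {DY : Matrix (Fin m) (Fin m) ℝ}
    (hDX : DX.IsSymm) (hDY : DY.IsSymm) : (gwHessian DX DY).IsSymmetric := fun P Q => by
  rw [← real_inner_comm P, inner_gwHessian, inner_gwHessian, ← Matrix.trace_transpose]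
  simp only [Matrix.transpose_mul, Matrix.transpose_transpose, hDX.eq, hDY.eq]
  simp only [Matrix.mul_assoc]
  rw [← Matrix.mul_assoc, Matrix.trace_mul_comm]
  simp only [Matrix.mul_assoc]
  rw [Matrix.trace_mul_comm]
  simp only [Matrix.mul_assoc]

theorem gwObjective_eq_inner (DX : Matrix (Fin n) (Fin n) ℝ) (DY : Matrix (Fin m) (Fin m) ℝ)
    (P : Coupling n m) : gwObjective DX DY P = 1 / 2 * inner ℝ (gwHessian DX DY P) P := by
  rw [inner_gwHessian, gwObjective]
  ring

theorem gradient_gwObjective {DX : Matrix (Fin n) (Fin n) ℝ} {DY : Matrix (Fin m) (Fin m) ℝ}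
    (hDX : DX.IsSymm) (hDY : DY.IsSymm) :
    gradient (gwObjective DX DY : Coupling n m → ℝ) = gwHessian DX DY := by
  refine gradient_eq fun P => hasGradientAt_iff_hasFDerivAt.2 ?_
  have hH := (LinearMap.toContinuousLinearMap (gwHessian DX DY)).hasFDerivAt (x := P)
  have h := (hH.inner ℝ (hasFDerivAt_id P)).const_mul (1 / 2 : ℝ)
  have hf : (gwObjective DX DY : Coupling n m → ℝ) =
      fun P => 1 / 2 * inner ℝ (gwHessian DX DY P) P := funext (gwObjective_eq_inner DX DY)
  rw [hf]
  refine h.congr_fderiv (ContinuousLinearMap.ext fun Q => ?_)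
  have := gwHessian_isSymmetric hDX hDY Q P
  rw [real_inner_comm] at this
  simp [real_inner_comm] at this ⊢
  rw [← this]
  ring

/-! ### The constraint sets, their directions, and criticality. -/

/-- The matrices with vanishing row sums. -/
def zeroRowSums (n m : ℕ) : Submodule ℝ (Coupling n m) where
  carrier := {P | ∀ i, ∑ j, P (i, j) = 0}
  add_mem' hP hQ i := by simp [Finset.sum_add_distrib, hP i, hQ i]
  zero_mem' i := by simp
  smul_mem' c P hP i := by simp [← Finset.mul_sum, hP i]

/-- The matrices with vanishing column sums. -/
def zeroColSums (n m : ℕ) : Submodule ℝ (Coupling n m) where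
  carrier := {P | ∀ j, ∑ i, P (i, j) = 0}
  add_mem' hP hQ j := by simp [Finset.sum_add_distrib, hP j, hQ j]
  zero_mem' j := by simp
  smul_mem' c P hP j := by simp [← Finset.mul_sum, hP j]

theorem mem_rowConstraint_iff {μ : Fin n → ℝ} {P : Coupling n m} :
    P ∈ rowConstraint μ ↔ (∀ p, 0 ≤ P p) ∧ ∀ i, ∑ j, P (i, j) = μ i := by
  simp [rowConstraint, funext_iff, Matrix.mulVec, dotProduct, couplingMatrix]

theorem mem_colConstraint_iff {ν : Fin m → ℝ} {P : Coupling n m} :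
    P ∈ colConstraint ν ↔ (∀ p, 0 ≤ P p) ∧ ∀ j, ∑ i, P (i, j) = ν j := by
  simp [colConstraint, funext_iff, Matrix.mulVec, dotProduct, couplingMatrix]

theorem sub_mem_zeroRowSums {μ : Fin n → ℝ} {P Q : Coupling n m} (hP : P ∈ rowConstraint μ)
    (hQ : Q ∈ rowConstraint μ) : P - Q ∈ zeroRowSums n m := fun i => by
  simp [(mem_rowConstraint_iff.1 hP).2 i, (mem_rowConstraint_iff.1 hQ).2 i]

theorem sub_mem_zeroColSums {ν : Fin m → ℝ} {P Q : Coupling n m} (hP : P ∈ colConstraint ν)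
    (hQ : Q ∈ colConstraint ν) : P - Q ∈ zeroColSums n m := fun j => by
  simp [(mem_colConstraint_iff.1 hP).2 j, (mem_colConstraint_iff.1 hQ).2 j]

theorem add_mem_feasible {μ : Fin n → ℝ} {ν : Fin m → ℝ} {P v : Coupling n m}
    (hP : P ∈ feasible μ ν) (hv : v ∈ zeroRowSums n m ⊓ zeroColSums n m)
    (hpos : ∀ p, 0 ≤ (P + v) p) : P + v ∈ feasible μ ν := by
  refine ⟨mem_rowConstraint_iff.2 ⟨hpos, fun i => ?_⟩, mem_colConstraint_iff.2 ⟨hpos, fun j => ?_⟩⟩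
  · simpa [Finset.sum_add_distrib, hv.1 i] using (mem_rowConstraint_iff.1 hP.1).2 i
  · simpa [Finset.sum_add_distrib, hv.2 j] using (mem_colConstraint_iff.1 hP.2).2 j

theorem isOpen_positiveOrthant (n m : ℕ) : IsOpen (positiveOrthant n m) := by
  have : positiveOrthant n m = ⋂ p, {P | 0 < P p} := by ext; simp [positiveOrthant]
  rw [this]
  exact isOpen_iInter_of_finite fun p => isOpen_lt continuous_const (by fun_prop)

/-- The feasible couplings with all entries at least `ε`. -/
def feasibleAbove (μ : Fin n → ℝ) (ν : Fin m → ℝ) (ε : ℝ) : Set (Coupling n m) :=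
  {P | P ∈ feasible μ ν ∧ ∀ p, ε ≤ P p}

theorem isCompact_feasibleAbove (μ : Fin n → ℝ) (ν : Fin m → ℝ) (ε : ℝ) :
    IsCompact (feasibleAbove μ ν ε) := by
  have hclosed : IsClosed (feasibleAbove μ ν ε) := by
    have : feasibleAbove μ ν ε = (⋂ p, {P | 0 ≤ P p}) ∩ (⋂ i, {P | ∑ j, P (i, j) = μ i}) ∩
        (⋂ j, {P | ∑ i, P (i, j) = ν j}) ∩ ⋂ p, {P | ε ≤ P p} := by
      ext P
      simp only [feasibleAbove, feasible, Set.mem_ofPred_eq, Set.mem_inter_iff,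
        mem_rowConstraint_iff, mem_colConstraint_iff, Set.mem_iInter]
      tauto
    rw [this]
    refine IsClosed.inter (IsClosed.inter (IsClosed.inter ?_ ?_) ?_) ?_ <;>
      refine isClosed_iInter fun p => ?_
    · exact isClosed_le continuous_const (by fun_prop)
    · exact isClosed_eq (by fun_prop) continuous_const
    · exact isClosed_eq (by fun_prop) continuous_const
    · exact isClosed_le continuous_const (by fun_prop)
  refine Metric.isCompact_of_isClosed_isBounded hclosed ?_
  -- Each entry is nonnegative and at most its row sum.
  refine isBounded_iff_forall_norm_le.2 ⟨√(∑ p : Fin n × Fin m, μ p.1 ^ 2), fun P hP => ?_⟩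
  rw [EuclideanSpace.norm_eq]
  refine Real.sqrt_le_sqrt (Finset.sum_le_sum fun p _ => ?_)
  obtain ⟨h0, hs⟩ := mem_rowConstraint_iff.1 hP.1.1
  rw [Real.norm_eq_abs, sq_abs]
  refine pow_le_pow_left₀ (h0 p) ?_ 2
  rw [← hs p.1]
  exact Finset.single_le_sum (f := fun j => P (p.1, j)) (fun j _ => h0 _) (Finset.mem_univ p.2)

/-- A feasible coupling at which the gradient is orthogonal to the directions of the feasible set
is critical. -/
theorem mem_gwCriticalSet_of_inner_eq_zero {DX : Matrix (Fin n) (Fin n) ℝ}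
    {DY : Matrix (Fin m) (Fin m) ℝ} {μ : Fin n → ℝ} {ν : Fin m → ℝ} {P : Coupling n m}
    (hP : P ∈ feasible μ ν)
    (hcrit : ∀ w ∈ zeroRowSums n m ⊓ zeroColSums n m,
      inner ℝ (gradient (gwObjective DX DY) P) w = 0) :
    P ∈ gwCriticalSet DX DY μ ν := by
  -- This splits the gradient into one part for each constraint; their negatives are normal vectors,
  -- with equality in the defining inequality.
  have hsup : (zeroRowSums n m ⊓ zeroColSums n m)ᗮ = (zeroRowSums n m)ᗮ ⊔ (zeroColSums n m)ᗮ := by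
    rw [← Submodule.orthogonal_orthogonal ((zeroRowSums n m)ᗮ ⊔ (zeroColSums n m)ᗮ),
      ← Submodule.inf_orthogonal, Submodule.orthogonal_orthogonal, Submodule.orthogonal_orthogonal]
  have hmem : gradient (gwObjective DX DY) P ∈ (zeroRowSums n m ⊓ zeroColSums n m)ᗮ :=
    (Submodule.mem_orthogonal' _ _).2 hcrit
  rw [hsup, Submodule.mem_sup] at hmem
  obtain ⟨v, hv, w, hw, hvw⟩ := hmem
  refine ⟨hP, -v, fun Q hQ => ?_, -w, fun Q hQ => ?_, by rw [← hvw]; abel⟩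
  · rw [inner_neg_left, (Submodule.mem_orthogonal' _ _).1 hv _ (sub_mem_zeroRowSums hQ hP.1),
      neg_zero]
  · rw [inner_neg_left, (Submodule.mem_orthogonal' _ _).1 hw _ (sub_mem_zeroColSums hQ hP.2),
      neg_zero]

/-! ### Optimality of a BPG step. -/

/-- The first-order optimality condition of a BPG step between entrywise positive couplings, along
the directions of the feasible set. -/
theorem bpgStep_inner_eq_zero {f h : Coupling n m → ℝ} {μ : Fin n → ℝ} {ν : Fin m → ℝ}
    {dom : Set (Coupling n m)} (hdom : positiveOrthant n m ⊆ dom) {t : ℝ} {P Q : Coupling n m}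
    (hQ : Q ∈ feasible μ ν) (hQpos : Q ∈ positiveOrthant n m) (hd : DifferentiableAt ℝ h Q)
    (hmin : IsMinOn (bpgModel f h t P) (feasible μ ν ∩ dom) Q)
    {v : Coupling n m} (hv : v ∈ zeroRowSums n m ⊓ zeroColSums n m) :
    inner ℝ (gradient f P) v + 1 / t * inner ℝ (gradient h Q - gradient h P) v = 0 := by
  have hline : HasDerivAt (fun s : ℝ => Q + s • v) v 0 := by
    simpa using ((hasDerivAt_id (0 : ℝ)).smul_const v).const_add Q
  have hgrad : HasFDerivAt h (InnerProductSpace.toDual ℝ _ (gradient h Q)) (Q + (0 : ℝ) • v) := by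
    simpa using hd.hasGradientAt.hasFDerivAt
  have h1 := hgrad.comp_hasDerivAt (0 : ℝ) hline
  rw [InnerProductSpace.toDual_apply_apply] at h1
  have h2 : HasDerivAt (fun s : ℝ => bpgModel f h t P (Q + s • v))
      (inner ℝ (gradient f P) v + 1 / t * (inner ℝ (gradient h Q) v - inner ℝ (gradient h P) v))
      0 := by
    have h3 : ∀ g : Coupling n m, HasDerivAt (fun s : ℝ => inner ℝ g (Q + s • v)) (inner ℝ g v) 0 :=
      fun g => by simpa using (hasDerivAt_const (0 : ℝ) g).inner ℝ hline
    have h4 : HasDerivAt (fun s : ℝ => inner ℝ (gradient h P) (Q + s • v - P))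
        (inner ℝ (gradient h P) v) 0 := by
      simpa only [inner_sub_right] using (h3 (gradient h P)).sub_const (inner ℝ (gradient h P) P)
    exact (h3 _).add (((h1.sub_const (h P)).sub h4).const_mul (1 / t))
  -- Positivity of `Q` allows small moves in both directions `±v`, hence an equality and not just a
  -- variational inequality.
  have hpos : ∀ᶠ s : ℝ in 𝓝 0, Q + s • v ∈ positiveOrthant n m :=
    hline.continuousAt.eventually_mem ((isOpen_positiveOrthant n m).mem_nhds (by simpa using hQpos))
  have hloc : IsLocalMin (fun s : ℝ => bpgModel f h t P (Q + s • v)) 0 := by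
    filter_upwards [hpos] with s hs
    rw [zero_smul, add_zero]
    exact hmin ⟨add_mem_feasible hQ (Submodule.smul_mem _ s hv) fun p => (hs p).le, hdom hs⟩
  rw [inner_sub_left]
  exact hloc.hasDerivAt_eq_zero h2

end GromovWasserstein

/-! ### Descent and gradient bounds for BPG. -/

theorem mainTheorem6 {n m : ℕ}
    (DX : Matrix (Fin n) (Fin n) ℝ) (DY : Matrix (Fin m) (Fin m) ℝ)
    (hDX : DX.IsSymm) (hDY : DY.IsSymm)
    (μ : Fin n → ℝ) (ν : Fin m → ℝ)
    (dom : Set (Coupling n m)) (h : Coupling n m → ℝ) (σ : ℝ)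
    (hh : IsBregmanKernel (feasible μ ν) dom h σ)
    (L : ℝ≥0) (hL : LipschitzWith L (gradient (gwObjective DX DY : Coupling n m → ℝ)))
    (t : ℕ → ℝ) (tlow tup : ℝ) (htlow : 0 < tlow) (htup : tup * (L : ℝ) ≤ σ)
    (ht : ∀ k, tlow ≤ t k ∧ t k < tup)
    (P : ℕ → Coupling n m)
    (hP : IsBPGSequence (gwObjective DX DY) (feasible μ ν) dom h t P)
    (ε : ℝ) (hε : 0 < ε) (hPε : ∀ k p, ε ≤ P k p) :
    ∃ Pstar ∈ gwCriticalSet DX DY μ ν, ConvergesRLinearly P Pstar := by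
  have hpos : ∀ k, P k ∈ positiveOrthant n m := fun k p => hε.trans_le (hPε k p)
  have hdiff : ∀ k, DifferentiableAt ℝ h (P k) := fun k =>
    hh.differentiableOn.differentiableAt ((isOpen_positiveOrthant n m).mem_nhds (hpos k))
  have hgrad := gradient_gwObjective hDX hDY
  have hsymm := gwHessian_isSymmetric hDX hDY
  have hσ := hh.modulus_pos
  have hKV : ∀ A ∈ feasibleAbove μ ν ε, ∀ B ∈ feasibleAbove μ ν ε,
      A - B ∈ zeroRowSums n m ⊓ zeroColSums n m := fun A hA B hB =>
    ⟨sub_mem_zeroRowSums hA.1.1 hB.1.1, sub_mem_zeroColSums hA.1.2 hB.1.2⟩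
  have hPK : ∀ k, P (k + 1) ∈ feasibleAbove μ ν ε := fun k => ⟨(hP k).1.1, hPε _⟩
  -- Compactness makes the local Lipschitz bound on `∇h` uniform.
  obtain ⟨M, hM⟩ := LocallyLipschitzOn.exists_lipschitzOnWith_of_compact
    (isCompact_feasibleAbove μ ν ε)
    (hh.locallyLipschitzOn.mono fun A hA p => hε.trans_le (hA.2 p))
  have htup0 : 0 < tup := htlow.trans_le ((ht 0).1.trans (ht 0).2.le)
  have hopt : ∀ k, ∀ v ∈ zeroRowSums n m ⊓ zeroColSums n m,
      inner ℝ (gwHessian DX DY (P k)) v =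
        -(1 / t k * inner ℝ (gradient h (P (k + 1)) - gradient h (P k)) v) := fun k v hv => by
    have := bpgStep_inner_eq_zero hh.positive_subset (hP k).1.1 (hpos (k + 1)) (hdiff (k + 1))
      (hP k).2 hv
    rw [hgrad] at this
    linarith
  -- The decrease is `-⟨HP, d⟩ - ½⟨Hd, d⟩ ≥ (σ/tup - L/2)‖d‖²`, and `L ≤ σ/tup`. Strong monotonicity
  -- of `∇h` supplies the full `σ`, not `σ/2`, which leaves a margin even when `tup * L = σ`.
  have hdesc : ∀ k, σ / (2 * tup) * ‖P (k + 1 + 1) - P (k + 1)‖ ^ 2 ≤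
      1 / 2 * inner ℝ (gwHessian DX DY (P (k + 1))) (P (k + 1)) -
        1 / 2 * inner ℝ (gwHessian DX DY (P (k + 1 + 1))) (P (k + 1 + 1)) := fun k => by
    have htk : 0 < t (k + 1) := htlow.trans_le (ht (k + 1)).1
    set d := P (k + 2) - P (k + 1) with hd
    have h1 := hopt (k + 1) d (hKV _ (hPK (k + 1)) _ (hPK k))
    have h2 : σ * ‖d‖ ^ 2 ≤ inner ℝ (gradient h (P (k + 2)) - gradient h (P (k + 1))) d :=
      hh.strongConvexOn.le_inner_gradient_sub
        ⟨(hPK k).1, hh.positive_subset (hpos _)⟩ ⟨(hPK (k + 1)).1, hh.positive_subset (hpos _)⟩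
        (hdiff _) (hdiff _)
    have h3 : inner ℝ (gwHessian DX DY d) d ≤ L * ‖d‖ ^ 2 := by
      have := hL.norm_sub_le d 0
      rw [hgrad, map_zero, sub_zero, sub_zero] at this
      calc _ ≤ ‖gwHessian DX DY d‖ * ‖d‖ := real_inner_le_norm _ _
        _ ≤ (L * ‖d‖) * ‖d‖ := by gcongr
        _ = _ := by ring
    have h4 : inner ℝ (gwHessian DX DY (P (k + 1))) d ≤ -(σ / tup * ‖d‖ ^ 2) := by
      rw [h1, neg_le_neg_iff]
      calc σ / tup * ‖d‖ ^ 2 ≤ σ / t (k + 1) * ‖d‖ ^ 2 := by gcongr; exact (ht (k + 1)).2.le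
        _ = 1 / t (k + 1) * (σ * ‖d‖ ^ 2) := by ring
        _ ≤ _ := by gcongr
    have h5 : L * ‖d‖ ^ 2 ≤ σ / tup * ‖d‖ ^ 2 := by
      gcongr
      rw [le_div_iff₀ htup0]
      linarith
    have h6 : P (k + 1 + 1) = P (k + 1) + d := by simp [hd]
    have h7 : inner ℝ (gwHessian DX DY d) (P (k + 1)) =
        inner ℝ (gwHessian DX DY (P (k + 1))) d := by
      rw [hsymm, real_inner_comm]
    have h8 : σ / (2 * tup) = 1 / 2 * (σ / tup) := by field_simp
    simp only [h6, map_add, inner_add_left, inner_add_right, h7, h8]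
    linarith
  have hstat : ∀ k, ∀ w ∈ zeroRowSums n m ⊓ zeroColSums n m,
      |inner ℝ (gwHessian DX DY (P (k + 1))) w| ≤
        M / tlow * ‖P (k + 1 + 1) - P (k + 1)‖ * ‖w‖ := fun k w hw => by
    have htk : 0 < t (k + 1) := htlow.trans_le (ht (k + 1)).1
    rw [hopt (k + 1) w hw, abs_neg, abs_mul, abs_of_pos (by positivity)]
    have h1 := hM.norm_sub_le (hPK (k + 1)) (hPK k)
    calc _ ≤ 1 / t (k + 1) * (‖gradient h (P (k + 1 + 1)) - gradient h (P (k + 1))‖ * ‖w‖) := by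
          gcongr; exact abs_real_inner_le_norm _ _
      _ ≤ 1 / tlow * ((M * ‖P (k + 1 + 1) - P (k + 1)‖) * ‖w‖) := by
          gcongr; exact (ht (k + 1)).1
      _ = _ := by ring
  obtain ⟨Q, hQK, hQ, hlin⟩ := hsymm.exists_convergesRLinearly
    (zeroRowSums n m ⊓ zeroColSums n m) (isCompact_feasibleAbove μ ν ε) hKV
    (x := fun k => P (k + 1)) hPK (a := σ / (2 * tup)) (c := M / tlow) (by positivity)
    (by positivity) hdesc hstat
  refine ⟨Q, mem_gwCriticalSet_of_inner_eq_zero hQK.1 fun w hw => ?_, hlin.of_succ⟩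
  rw [hgrad]
  exact hQ w hw
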